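/- Let $v_1,\dots,v_n\in\mathbb{R}^d$ and let $\mathcal{M}=([n],\mathcal{I})$ be a matroid of rank $d$. For $S\subseteq[n]$ let $\mathrm{vol}(S)$ be the $d$-dimensional volume of the parallelepiped spanned by $\{v_i\}_{i\in S}$, so that $\mathrm{vol}(S)^2=\det\big(\sum_{i\in S}v_iv_i^\top\big)$ when $|S|=d$. Let $S$ be a basis of $\mathcal{M}$ with $\mathrm{vol}(S)>0$; then for every $u\notin S$ there are unique $a_{us}\in\mathbb{R}$ $(s\in S)$ with $v_u=\sum_{s\in S}a_{us}v_s$. The exchange graph $G(S)$ is the directed bipartite graph with parts $[n]\setminus S$ and $S$ that has a forward arc $u\to s$ of weight $w_0(u,s)=-\log|a_{us}|$ (which is $+\infty$ if $a_{us}=0$) for all $u\notin S$, $s\in S$, and a backward arc $s\to u$ of weight $0$ for all $s\in S$, $u\notin S$ such that $(S\setminus\{s\})\cup\{u\}$ is a basis of $\mathcal{M}$. For a directed cycle $C$ of $G(S)$ (without repeated vertices; cycles with two arcs are allowed), let $V(C)$ be its vertex set, $|C|$ its number of arcs, and $w_0(C)$ the sum of the weights of its arcs. Put $f(\ell)=2(\ell!)^3$.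 The cycle $C$ is $f$-violating if $w_0(C)<-\log f(|C|/2)$, and it is a minimal $f$-violating cycle if moreover no directed cycle $C'$ of $G(S)$ with $V(C')\subsetneq V(C)$ is $f$-violating. **Lemma (Cycle to Determinant).** If $C$ is a minimal $f$-violating cycle in $G(S)$, then $\mathrm{vol}(S\,\Delta\,V(C))\ge 2\,\mathrm{vol}(S)$, and $S\,\Delta\,V(C)$ is again a basis of $\mathcal{M}$. -/

import Mathlib

open MeasureTheory Module
open scoped Nat symmDiff

noncomputable section

/-- The `d`-dimensional volume of the parallelepiped spanned by the vectors `v i`, `i ∈ S`,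
in Euclidean space `ℝ^d`. -/
def vol {α : Type*} {d : ℕ} (v : α → EuclideanSpace ℝ (Fin d)) (S : Finset α) : ℝ :=
  volume.real (parallelepiped (fun i : S => v i))

/-- The volume of `d` vectors in `ℝ^d` is the absolute value of their determinant. -/
theorem vol_eq_abs_det {α : Type*} {d : ℕ} (v : α → EuclideanSpace ℝ (Fin d)) (S : Finset α)
    (e : Fin d ≃ S) :
    vol v S = |Matrix.det (Matrix.of fun i j => v (e j) i)| := by
  classical
  let b := (EuclideanSpace.basisFun (Fin d) ℝ).reindex e
  have h := Measure.addHaar_parallelepiped b.toBasis (fun i : S => v i)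
  rw [OrthonormalBasis.addHaar_eq_volume] at h
  rw [vol, measureReal_def, h, ENNReal.toReal_ofReal (abs_nonneg _), Basis.det_apply,
    ← Matrix.det_reindex_self e.symm]
  congr 2
  ext i j
  simp [b, Basis.toMatrix_apply]

/-- `vol(S)² = det (∑_{i ∈ S} vᵢ vᵢᵀ)` whenever `|S| = d`. -/
theorem vol_sq {α : Type*} {d : ℕ} (v : α → EuclideanSpace ℝ (Fin d)) (S : Finset α)
    (hS : S.card = d) :
    vol v S ^ 2 = Matrix.det (∑ i ∈ S, Matrix.vecMulVec (v i) (v i)) := by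
  have e : Fin d ≃ S := (S.equivFinOfCardEq hS).symm
  rw [vol_eq_abs_det v S e, sq_abs, sq]
  nth_rewrite 2 [← Matrix.det_transpose]
  rw [← Matrix.det_mul]
  congr 1
  ext i j
  rw [Matrix.mul_apply, Matrix.sum_apply, ← Finset.sum_coe_sort S, ← e.sum_comp]
  simp [Matrix.vecMulVec_apply]

/-- `coeff v S u s` is the coefficient of `v s` in the expression of the vector `v u` in the
basis `(v i)_{i ∈ S}` of `ℝ^d`. (The value is `0` if these vectors are not a basis; in the
theorem they are one, because `S` has `d` elements and positive volume.) -/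
def coeff {α : Type*} {d : ℕ} (v : α → EuclideanSpace ℝ (Fin d)) (S : Finset α)
    (u : α) (s : S) : ℝ :=
  open Classical in
  if h : LinearIndependent ℝ (fun i : S => v i) ∧
      ⊤ ≤ Submodule.span ℝ (Set.range (fun i : S => v i)) then
    (Basis.mk h.1 h.2).repr (v u) s
  else 0

/-- If `|S| = d` and `vol(S) > 0`, the numbers `coeff v S u s` do express `v u` in `S`. -/
theorem coeff_spec {α : Type*} {d : ℕ} (v : α → EuclideanSpace ℝ (Fin d)) (S : Finset α)
    (hS : S.card = d) (hvol : 0 < vol v S) (u : α) :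
    v u = ∑ s : S, coeff v S u s • v s := by
  classical
  have e : Fin d ≃ S := (S.equivFinOfCardEq hS).symm
  let b := (EuclideanSpace.basisFun (Fin d) ℝ).reindex e
  have h := Measure.addHaar_parallelepiped b.toBasis (fun i : S => v i)
  rw [OrthonormalBasis.addHaar_eq_volume] at h
  have hd : IsUnit (b.toBasis.det (fun i : S => v i)) := by
    rw [isUnit_iff_ne_zero]
    intro h0
    rw [vol, measureReal_def, h, h0] at hvol
    simp at hvol
  have hb := (Module.Basis.is_basis_iff_det b.toBasis).2 hd
  have hb' : LinearIndependent ℝ (fun i : S => v i) ∧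
      ⊤ ≤ Submodule.span ℝ (Set.range (fun i : S => v i)) := ⟨hb.1, hb.2.ge⟩
  have := (Basis.mk hb'.1 hb'.2).sum_repr (v u)
  simp only [coeff, dif_pos hb']
  simpa using this.symm

/-- The exchange graph `G(S)` on the elements of the matroid `M`: a forward arc from every
`u ∈ E \ S` to every `s ∈ S`, and a backward arc from `s ∈ S` to `u ∈ E \ S` whenever
`S - s + u` is a basis of `M`. -/
def exchangeGraph {α : Type*} [DecidableEq α] (M : Matroid α) (S : Finset α) : Digraph α where
  Adj x y :=
    (x ∈ M.E ∧ x ∉ S ∧ y ∈ S) ∨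
    (x ∈ S ∧ y ∈ M.E ∧ y ∉ S ∧ M.IsBase (insert y (S.erase x) : Finset α))

/-- A directed cycle of a digraph: distinct vertices `x₀, …, x_{k-1}` with `k > 0`, and the arcs
`x₀ → x₁ → ⋯ → x_{k-1} → x₀`. -/
structure DirectedCycle {α : Type*} (G : Digraph α) where
  /-- The number of arcs. -/
  length : ℕ
  length_pos : 0 < length
  vertex : Fin length → α
  injective : Function.Injective vertex
  adj : ∀ i, G.Adj (vertex i) (vertex (finRotate length i))

/-- The vertex set `V(C)` of a directed cycle. -/
def DirectedCycle.verts {α : Type*} [DecidableEq α] {G : Digraph α} (C : DirectedCycle G) :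
    Finset α :=
  Finset.univ.image C.vertex

/-- The weight `w₀` of an arc `x → y` of the exchange graph. A forward arc (the arcs whose
head lies in `S`) has weight `-log |a_{xy}|`, which is `+∞` if the coefficient `a_{xy}`
vanishes. A backward arc has weight `0`. -/
def arcWeight {α : Type*} [DecidableEq α] {d : ℕ} (v : α → EuclideanSpace ℝ (Fin d))
    (S : Finset α) (x y : α) : EReal :=
  if h : y ∈ S then
    if coeff v S x ⟨y, h⟩ = 0 then ⊤
    else ((-Real.log |coeff v S x ⟨y, h⟩| : ℝ) : EReal)
  else 0

/-- The weight `w₀(C)` of a cycle: the sum of the weights of its arcs. -/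
def cycleWeight {α : Type*} [DecidableEq α] {d : ℕ} (v : α → EuclideanSpace ℝ (Fin d))
    (M : Matroid α) (S : Finset α) (C : DirectedCycle (exchangeGraph M S)) : EReal :=
  ∑ i, arcWeight v S (C.vertex i) (C.vertex (finRotate C.length i))

/-- The function `f(ℓ) = 2 (ℓ!)³`. -/
def violationBound (l : ℕ) : ℝ := 2 * (l ! : ℝ) ^ 3

/-- `C` is `f`-violating: `w₀(C) < -log f(|C|/2)`, with `|C|` the number of arcs of `C`
(an even number, since the exchange graph is bipartite). -/
def IsViolating {α : Type*} [DecidableEq α] {d : ℕ} (v : α → EuclideanSpace ℝ (Fin d))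
    (M : Matroid α) (S : Finset α) (C : DirectedCycle (exchangeGraph M S)) : Prop :=
  cycleWeight v M S C < ((-Real.log (violationBound (C.length / 2)) : ℝ) : EReal)

/-- `C` is a minimal `f`-violating cycle: it is `f`-violating, and no cycle whose vertex set is a
proper subset of `V(C)` is. -/
def IsMinimalViolating {α : Type*} [DecidableEq α] {d : ℕ}
    (v : α → EuclideanSpace ℝ (Fin d)) (M : Matroid α) (S : Finset α)
    (C : DirectedCycle (exchangeGraph M S)) : Prop :=
  IsViolating v M S C ∧
    ∀ C' : DirectedCycle (exchangeGraph M S), C'.verts ⊂ C.verts → ¬ IsViolating v M S C'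

end

/-! Write `C` as `u 0 → s 0 → u 1 → ⋯` with `l` forward arcs, and let `w i` be the logarithm of the
absolute coefficient on `u i → s i`. Violation says that the `w i` sum to more than `log f(l)`.
Every chord closes a shorter cycle with `x < l` forward arcs, and minimality bounds its gain by `log
f(x)`. Since `log f(x)` lies below `(x / l) * log f(l)` by `log 2 * decayExp l x`, chords are
exponentially weak relative to the mean of `w` (`log_violationBound_sub_le`).

The centred partial sums of `w` form an `l`-periodic potential. Rescaling rows and columns of the
coefficient matrix by it gives diagonal entries of modulus 1 and off-diagonal row sums at most some
`r < 1`. By Gershgorin the rescaled determinant is at least `(1 - r) ^ l`. Undoing the scaling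
multiplies by at least `f(l) = 2 (l!)³`, and `(1 - r) ^ l * (l!)³ ≥ 1` (`exists_sum_decay_le`). So
the determinant, which is the volume ratio by `vol_exchange`, is at least 2.

The same potential strictly increases along every backward chord, from the partner of its tail to
its head. The exchanges `s i ↦ u (i + 1)` are therefore triangular and can be made together
(`Matroid.isBase_diff_union_of_triangular`). -/

/-! ### Growth of factorials and of the violation bound -/

theorem factorial_mul_two_pow_le (x : ℕ) : x ! * 2 ^ x ≤ (x + 1) ^ x := by
  induction x with
  | zero => simp
  | succ x ih =>
    -- Bernoulli: `(1 + 1/(x+1)) ^ (x+1) ≥ 2`, with denominators cleared.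
    have h : 2 * (x + 1) ^ (x + 1) ≤ (x + 2) ^ (x + 1) := by
      have hx : (0 : ℝ) < x + 1 := by positivity
      have h1 := one_add_mul_le_pow (a := 1 / ((x : ℝ) + 1))
        (by linarith [one_div_pos.2 hx]) (x + 1)
      have h2 : (1 + ((x + 1 : ℕ) : ℝ) * (1 / ((x : ℝ) + 1))) = 2 := by
        push_cast
        field_simp
        norm_num
      rw [h2] at h1
      have h3 := mul_le_mul_of_nonneg_right h1 (pow_nonneg hx.le (x + 1))
      rw [← mul_pow, show (1 + 1 / ((x : ℝ) + 1)) * (x + 1) = x + 2 by field_simp; ring] at h3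
      exact_mod_cast h3
    calc (x + 1)! * 2 ^ (x + 1) = 2 * (x + 1) * (x ! * 2 ^ x) := by
          rw [Nat.factorial_succ]; ring
      _ ≤ 2 * (x + 1) * (x + 1) ^ x := Nat.mul_le_mul_left _ ih
      _ = 2 * (x + 1) ^ (x + 1) := by ring
      _ ≤ (x + 1 + 1) ^ (x + 1) := h

theorem factorial_pow_mul_two_pow_le (x y : ℕ) :
    x ! ^ (x + y) * 2 ^ (x * y) ≤ (x + y)! ^ x := by
  calc x ! ^ (x + y) * 2 ^ (x * y) = x ! ^ x * (x ! * 2 ^ x) ^ y := by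
        rw [mul_pow, ← pow_mul, pow_add]; ring
    _ ≤ x ! ^ x * ((x + 1) ^ x) ^ y :=
        Nat.mul_le_mul_left _ (Nat.pow_le_pow_left (factorial_mul_two_pow_le x) y)
    _ = (x ! * (x + 1) ^ y) ^ x := by rw [mul_pow, ← pow_mul, ← pow_mul, mul_comm x y]
    _ ≤ (x + y)! ^ x := Nat.pow_le_pow_left Nat.factorial_mul_pow_le_factorial x

theorem violationBound_pos (l : ℕ) : 0 < violationBound l := by
  unfold violationBound; positivity

theorem log_violationBound (l : ℕ) :
    Real.log (violationBound l) = Real.log 2 + 3 * Real.log (l ! : ℝ) := by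
  rw [violationBound, Real.log_mul (by norm_num) (by positivity), Real.log_pow]
  norm_num

/-- The cube in `f` turns the gain `2 ^ (x * y)` for factorials into `3 * x * y`; the leading factor
2 of `f` costs the `-y`. -/
theorem log_violationBound_le {x y : ℕ} :
    (x + y) * Real.log (violationBound x) + Real.log 2 * (y * (3 * x - 1)) ≤
      x * Real.log (violationBound (x + y)) := by
  have h : ((x ! ^ (x + y) * 2 ^ (x * y) : ℕ) : ℝ) ≤ (((x + y)! ^ x : ℕ) : ℝ) :=
    Nat.cast_le.2 (factorial_pow_mul_two_pow_le x y)
  push_cast at h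
  have h2 := Real.log_le_log (by positivity) h
  rw [Real.log_mul (by positivity) (by positivity), Real.log_pow, Real.log_pow, Real.log_pow] at h2
  push_cast at h2
  rw [log_violationBound, log_violationBound]
  nlinarith

/-- The exponent of the geometric decay of `violationBound x / (violationBound l) ^ (x / l)`. -/
noncomputable def decayExp (l x : ℕ) : ℝ := ((l : ℝ) - x) * (3 * x - 1) / l

/-- For use with `L` the sum of `w` over the cycle: `L / l` is then the mean of `w`, and the left
side is what a short cycle with `x` forward arcs may gain beyond `x` times that mean. -/
theorem log_violationBound_sub_le {l x : ℕ} (hl : 0 < l) (hx : x ≤ l) {L : ℝ}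
    (hL : Real.log (violationBound l) ≤ L) :
    Real.log (violationBound x) - x * (L / l) ≤ Real.log 2 * -decayExp l x := by
  obtain ⟨y, rfl⟩ := Nat.exists_eq_add_of_le hx
  have h := @log_violationBound_le x y
  have hl' : (0 : ℝ) < ((x + y : ℕ) : ℝ) := by exact_mod_cast hl
  have h2 : (x : ℝ) * Real.log (violationBound (x + y)) ≤ x * L :=
    mul_le_mul_of_nonneg_left hL (by positivity)
  have e1 : Real.log (violationBound x) - x * (L / ((x + y : ℕ) : ℝ)) =
      (((x + y : ℕ) : ℝ) * Real.log (violationBound x) - x * L) / ((x + y : ℕ) : ℝ) := by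
    field_simp
  have e2 : Real.log 2 * -decayExp (x + y) x =
      -(Real.log 2 * (y * (3 * x - 1))) / ((x + y : ℕ) : ℝ) := by
    rw [decayExp]; push_cast; ring
  rw [e1, e2]
  apply div_le_div_of_nonneg_right _ hl'.le
  push_cast
  linarith

theorem decayExp_pos {l x : ℕ} (hx : 1 ≤ x) (hxl : x < l) : 0 < decayExp l x := by
  have h1 : (1 : ℝ) ≤ x := by exact_mod_cast hx
  have h2 : (x : ℝ) < l := by exact_mod_cast hxl
  exact div_pos (mul_pos (by linarith) (by linarith)) (by linarith)

/-- The chord bound for the convex function `t ↦ 2 ^ (-t)` on `[n, n + 1]`. -/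
theorem two_rpow_neg_le {n : ℕ} {t c : ℝ} (h : n + c ≤ t) (hc : 0 ≤ c) (hc1 : c ≤ 1) :
    (2 : ℝ) ^ (-t) ≤ (1 / 2) ^ n * (1 - c / 2) := by
  calc (2 : ℝ) ^ (-t) ≤ 2 ^ (-(n + c)) :=
        Real.rpow_le_rpow_of_exponent_le (by norm_num) (by linarith)
    _ = (1 / 2) ^ n * (1 + (-1 / 2)) ^ c := by
        rw [neg_add, Real.rpow_add (by norm_num), Real.rpow_neg (by norm_num), Real.rpow_natCast,
          Real.rpow_neg (by norm_num), ← Real.inv_rpow (by norm_num),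
          show (1 : ℝ) + -1 / 2 = 2⁻¹ by norm_num, one_div, inv_pow]
    _ ≤ (1 / 2) ^ n * (1 + c * (-1 / 2)) := by
        gcongr
        exact rpow_one_add_le_one_add_mul_self (by norm_num) hc hc1
    _ = _ := by ring

/-! ### Determinants of diagonally dominant matrices -/

/-- The determinant is the product of the complex eigenvalues. By Gershgorin each lies within `r` of
a diagonal entry of modulus 1, hence has modulus at least `1 - r`. -/
theorem one_sub_pow_le_abs_det {n : ℕ} (A : Matrix (Fin n) (Fin n) ℝ) {r : ℝ} (hr : r ≤ 1)
    (hd : ∀ i, |A i i| = 1) (hs : ∀ i, ∑ j ∈ Finset.univ.erase i, |A i j| ≤ r) :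
    (1 - r) ^ n ≤ |A.det| := by
  let B : Matrix (Fin n) (Fin n) ℂ := A.map (algebraMap ℝ ℂ)
  have hB : B.det = (A.det : ℂ) := by
    have := (RingHom.map_det (algebraMap ℝ ℂ) A).symm
    simpa [B] using this
  have hdet : |A.det| = ((B.charpoly.roots).map (fun z => ‖z‖)).prod := by
    rw [← Real.norm_eq_abs, ← Complex.norm_real, ← hB, Matrix.det_eq_prod_roots_charpoly]
    exact map_multiset_prod (normHom : ℂ →*₀ ℝ) _
  have hcard : B.charpoly.roots.card = n := by
    rw [IsAlgClosed.card_roots_eq_natDegree, Matrix.charpoly_natDegree_eq_dim, Fintype.card_fin]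
  rw [hdet]
  have key : ∀ z ∈ B.charpoly.roots, 1 - r ≤ ‖z‖ := by
    intro z hz
    have hz' : Module.End.HasEigenvalue (Matrix.toLin' B) z := by
      rw [Module.End.hasEigenvalue_iff_isRoot_charpoly]
      simpa using (Polynomial.mem_roots'.1 hz).2
    obtain ⟨k, hk⟩ := eigenvalue_mem_ball hz'
    rw [Metric.mem_closedBall, dist_comm, dist_eq_norm] at hk
    have h1 : ‖B k k‖ = 1 := by simpa [B] using hd k
    have h2 : ∑ j ∈ Finset.univ.erase k, ‖B k j‖ ≤ r := by simpa [B] using hs k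
    have := norm_sub_norm_le (B k k) z
    linarith
  clear_value B
  have := Multiset.prod_map_le_prod_map₀ (s := B.charpoly.roots) (fun _ => 1 - r) (fun z => ‖z‖)
    (fun _ _ => by linarith) key
  simpa [hcard] using this

/-! ### Summing the decay over a row -/

theorem sum_le_sum_add_sum_reflect {l : ℕ} {h a b : ℕ → ℝ} (ha : ∀ k, 0 ≤ a k) (hb : ∀ k, 0 ≤ b k)
    (h1 : ∀ x, 1 ≤ x → 2 * x ≤ l → h x ≤ a x)
    (h2 : ∀ x y, 1 ≤ y → 2 * y ≤ l → x + y = l → h x ≤ b y) :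
    ∑ x ∈ Finset.Ico 1 l, h x ≤ ∑ x ∈ Finset.range l, (a x + b x) := by
  have e : ∑ x ∈ Finset.Ico 1 l, b (l - x) = ∑ x ∈ Finset.Ico 1 l, b x := by
    refine Finset.sum_nbij' (fun x => l - x) (fun x => l - x) ?_ ?_ ?_ ?_ fun _ _ => rfl <;>
      simp only [Finset.mem_Ico] <;> intros <;> omega
  calc ∑ x ∈ Finset.Ico 1 l, h x ≤ ∑ x ∈ Finset.Ico 1 l, (a x + b (l - x)) := by
        refine Finset.sum_le_sum fun x hx => ?_
        rw [Finset.mem_Ico] at hx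
        rcases le_total (2 * x) l with hxl | hxl
        · linarith [h1 x hx.1 hxl, hb (l - x)]
        · linarith [h2 x (l - x) (by omega) (by omega) (by omega), ha x]
    _ = ∑ x ∈ Finset.Ico 1 l, (a x + b x) := by
        rw [Finset.sum_add_distrib, e, Finset.sum_add_distrib]
    _ ≤ _ := Finset.sum_le_sum_of_subset_of_nonneg
        (fun x hx => Finset.mem_range.2 (Finset.mem_Ico.1 hx).2)
        fun x _ _ => add_nonneg (ha x) (hb x)

/-- A summable majorant: prescribed values at `1` and `2`, geometric decay from `3` on. -/
noncomputable def majorant (p q : ℝ) : ℕ → ℝ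
  | 0 => 0
  | 1 => p
  | 2 => q
  | k + 3 => 1 / 16 * (3 / 8) ^ k

theorem majorant_nonneg {p q : ℝ} (hp : 0 ≤ p) (hq : 0 ≤ q) : ∀ k, 0 ≤ majorant p q k
  | 0 => le_rfl
  | 1 => hp
  | 2 => hq
  | k + 3 => by rw [majorant]; positivity

theorem sum_majorant_le (p q : ℝ) (k : ℕ) :
    ∑ x ∈ Finset.range (k + 3), majorant p q x ≤ p + q + 1 / 10 * (1 - (3 / 8) ^ k) := by
  induction k with
  | zero => simp [Finset.sum_range_succ, majorant]
  | succ k ih =>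
    rw [show k + 1 + 3 = (k + 3) + 1 by ring, Finset.sum_range_succ, majorant, pow_succ]
    linarith

theorem two_rpow_neg_le_geom {k : ℕ} {t : ℝ} (h : (3 * ((k + 3 : ℕ) : ℝ) - 1) / 2 ≤ t) :
    (2 : ℝ) ^ (-t) ≤ 1 / 16 * (3 / 8) ^ k := by
  -- The exponent is at least `4 + 3k/2`, which gives the prefactor `1/16` and the ratio `2 ^
  -- (-3/2)`.
  have h8 : (2 : ℝ) ^ (-(3 / 2) : ℝ) ≤ 3 / 8 := by
    have := two_rpow_neg_le (n := 1) (c := 1 / 2) (t := 3 / 2) (by norm_num) (by norm_num)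
      (by norm_num)
    linarith
  calc (2 : ℝ) ^ (-t) ≤ 2 ^ (-(4 : ℝ) + -(3 / 2) * k) := by
        refine Real.rpow_le_rpow_of_exponent_le (by norm_num) ?_
        push_cast at h
        linarith
    _ = 1 / 16 * ((2 : ℝ) ^ (-(3 / 2) : ℝ)) ^ k := by
        rw [Real.rpow_add (by norm_num), Real.rpow_mul_natCast (by norm_num)]
        norm_num [Real.rpow_neg]
    _ ≤ _ := by gcongr

theorem le_decayExp_of_two_mul_le {l x : ℕ} (hx : 1 ≤ x) (h : 2 * x ≤ l) :
    (3 * (x : ℝ) - 1) / 2 ≤ decayExp l x := by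
  have h1 : (1 : ℝ) ≤ x := by exact_mod_cast hx
  have h2 : 2 * (x : ℝ) ≤ l := by exact_mod_cast h
  rw [decayExp, div_le_div_iff₀ (by norm_num) (by linarith)]
  nlinarith [mul_nonneg (by linarith : (0 : ℝ) ≤ 3 * x - 1) (sub_nonneg.2 h2)]

theorem le_decayExp_of_add_eq {l x y : ℕ} (hy : 1 ≤ y) (h : 2 * y ≤ l) (hxy : x + y = l) :
    (3 * (y : ℝ) - 1) / 2 ≤ decayExp l x := by
  have h1 : (1 : ℝ) ≤ y := by exact_mod_cast hy
  have h2 : 2 * (y : ℝ) ≤ l := by exact_mod_cast h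
  have h3 : (l : ℝ) = x + y := by exact_mod_cast hxy.symm
  rw [h3] at h2
  rw [decayExp, h3, div_le_div_iff₀ (by norm_num) (by linarith)]
  nlinarith [mul_nonneg (by linarith : (0 : ℝ) ≤ 3 * y + 1) (by linarith : (0 : ℝ) ≤ x - y)]

theorem sum_two_rpow_neg_decayExp_le {l : ℕ} (hl : 6 ≤ l) :
    ∑ x ∈ Finset.Ico 1 l, (2 : ℝ) ^ (-decayExp l x) ≤ 24 / 25 := by
  have hl' : (6 : ℝ) ≤ l := by exact_mod_cast hl
  have hl0 : (0 : ℝ) < l := by linarith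
  -- The range is folded at `l / 2`. The four constants are chord bounds at exponents `5/3`, `10/3`
  -- (for `x = 1, 2`) and `7/3`, `11/3` (for `l - x = 1, 2`), the values of `decayExp` at `l = 6`.
  -- With the two tails of `1/10` they total less than `24/25`.
  refine (sum_le_sum_add_sum_reflect (a := majorant (1 / 3) (5 / 48))
    (b := majorant (5 / 24) (1 / 12)) (majorant_nonneg (by norm_num) (by norm_num))
    (majorant_nonneg (by norm_num) (by norm_num)) ?_ ?_).trans ?_
  · rintro (_ | _ | _ | k) hx hxl
    · omega
    · refine (two_rpow_neg_le (n := 1) (c := 2 / 3) ?_ (by norm_num) (by norm_num)).trans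
        (by norm_num [majorant])
      rw [decayExp, le_div_iff₀ hl0]; push_cast; linarith
    · refine (two_rpow_neg_le (n := 3) (c := 1 / 3) ?_ (by norm_num) (by norm_num)).trans
        (by norm_num [majorant])
      rw [decayExp, le_div_iff₀ hl0]; push_cast; linarith
    · exact two_rpow_neg_le_geom (le_decayExp_of_two_mul_le hx hxl)
  · rintro x (_ | _ | _ | k) hy hyl hxy
    · omega
    · refine (two_rpow_neg_le (n := 2) (c := 1 / 3) ?_ (by norm_num) (by norm_num)).trans
        (by norm_num [majorant])
      have h3 : (x : ℝ) = l - 1 := by rw [← hxy]; push_cast; ring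
      rw [decayExp, le_div_iff₀ hl0, h3]; push_cast; linarith
    · refine (two_rpow_neg_le (n := 3) (c := 2 / 3) ?_ (by norm_num) (by norm_num)).trans
        (by norm_num [majorant])
      have h3 : (x : ℝ) = l - 2 := by rw [← hxy]; push_cast; ring
      rw [decayExp, le_div_iff₀ hl0, h3]; push_cast; linarith
    · exact two_rpow_neg_le_geom (le_decayExp_of_add_eq hy hyl hxy)
  · obtain ⟨k, rfl⟩ := Nat.exists_eq_add_of_le' (show 3 ≤ l by omega)
    rw [Finset.sum_add_distrib]
    have := sum_majorant_le (1 / 3) (5 / 48) k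
    have := sum_majorant_le (5 / 24) (1 / 12) k
    have : (0 : ℝ) ≤ (3 / 8) ^ k := by positivity
    linarith

/-- Each step beyond `m` multiplies the left by `a` and the right by at least `(m + 1) ^ 3`. -/
theorem pow_le_factorial_cube {l a m : ℕ} (hml : m ≤ l) (ha : a ≤ (m + 1) ^ 3)
    (hm : a ^ m ≤ m ! ^ 3) : a ^ l ≤ l ! ^ 3 := by
  induction l, hml using Nat.le_induction with
  | base => exact hm
  | succ l hl ih =>
    rw [pow_succ, Nat.factorial_succ, mul_pow, mul_comm]
    exact Nat.mul_le_mul (ha.trans (Nat.pow_le_pow_left (by omega) 3)) ih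

theorem exists_sum_decay_le (l : ℕ) (hl : 0 < l) :
    ∃ r < 1, ∑ x ∈ Finset.Ico 1 l, (2 : ℝ) ^ (-decayExp l x) ≤ r ∧
      1 ≤ (1 - r) ^ l * (l ! : ℝ) ^ 3 := by
  have key : ∀ a m : ℕ, 0 < a → m ≤ l → a ≤ (m + 1) ^ 3 → a ^ m ≤ m ! ^ 3 →
      1 ≤ (1 - (1 - 1 / (a : ℝ))) ^ l * (l ! : ℝ) ^ 3 := by
    intro a m h0 h1 h2 h3
    have h4 : ((a ^ l : ℕ) : ℝ) ≤ ((l ! ^ 3 : ℕ) : ℝ) :=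
      Nat.cast_le.2 (pow_le_factorial_cube h1 h2 h3)
    push_cast at h4
    rw [sub_sub_cancel, one_div, inv_pow, inv_mul_eq_div, one_le_div (by positivity)]
    exact h4
  have bd : ∀ {n x : ℕ} (c : ℝ), n + c ≤ decayExp l x → 0 ≤ c → c ≤ 1 →
      (2 : ℝ) ^ (-decayExp l x) ≤ (1 / 2) ^ n * (1 - c / 2) :=
    fun c h1 h2 h3 => two_rpow_neg_le h1 h2 h3
  obtain hl6 | hl6 := le_or_gt 6 l
  -- The value 25 is small enough for `25 ^ 6 ≤ (6!)³` and large enough for the row sum. Smaller `l`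
  -- are treated singly; for `l = 3` the choice 6 is exact, as `6 ^ 3 = (3!)³`.
  · refine ⟨1 - 1 / (25 : ℕ), by norm_num, ?_, key 25 6 (by norm_num) hl6 (by norm_num)
      (by norm_num [Nat.factorial])⟩
    exact (sum_two_rpow_neg_decayExp_le hl6).trans (by norm_num)
  · interval_cases l
    · exact ⟨0, by norm_num, by simp, by norm_num⟩
    · refine ⟨1 / 2, by norm_num, ?_, by norm_num [Nat.factorial]⟩
      have h1 := @bd 1 1 0 (by norm_num [decayExp]) (by norm_num) (by norm_num)
      norm_num [Finset.sum_Ico_eq_sum_range] at h1 ⊢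
      linarith
    · refine ⟨1 - 1 / (6 : ℕ), by norm_num, ?_, key 6 3 (by norm_num) (by norm_num) (by norm_num)
        (by norm_num [Nat.factorial])⟩
      have h1 := @bd 1 1 (1 / 3) (by norm_num [decayExp]) (by norm_num) (by norm_num)
      have h2 := @bd 1 2 (2 / 3) (by norm_num [decayExp]) (by norm_num) (by norm_num)
      norm_num [Finset.sum_Ico_eq_sum_range, Finset.sum_range_succ] at h1 h2 ⊢
      linarith
    · refine ⟨1 - 1 / (10 : ℕ), by norm_num, ?_, key 10 4 (by norm_num) (by norm_num)
        (by norm_num) (by norm_num [Nat.factorial])⟩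
      have h1 := @bd 1 1 (1 / 2) (by norm_num [decayExp]) (by norm_num) (by norm_num)
      have h2 := @bd 2 2 (1 / 2) (by norm_num [decayExp]) (by norm_num) (by norm_num)
      have h3 := @bd 2 3 0 (by norm_num [decayExp]) (by norm_num) (by norm_num)
      norm_num [Finset.sum_Ico_eq_sum_range, Finset.sum_range_succ] at h1 h2 h3 ⊢
      linarith
    · refine ⟨1 - 1 / (10 : ℕ), by norm_num, ?_, key 10 5 (by norm_num) (by norm_num)
        (by norm_num) (by norm_num [Nat.factorial])⟩
      have h1 := @bd 1 1 (3 / 5) (by norm_num [decayExp]) (by norm_num) (by norm_num)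
      have h2 := @bd 3 2 0 (by norm_num [decayExp]) (by norm_num) (by norm_num)
      have h3 := @bd 3 3 (1 / 5) (by norm_num [decayExp]) (by norm_num) (by norm_num)
      have h4 := @bd 2 4 (1 / 5) (by norm_num [decayExp]) (by norm_num) (by norm_num)
      norm_num [Finset.sum_Ico_eq_sum_range, Finset.sum_range_succ] at h1 h2 h3 h4 ⊢
      linarith

/-! ### Simultaneous exchange in a matroid -/

/-- All exchange arcs into `e` are encoded in one circuit, which can be compared between different
bases. -/
theorem Matroid.IsBase.exchange_iff_mem_fundCircuit {α : Type*} {M : Matroid α} {B : Set α}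
    {e x : α} (hB : M.IsBase B) (he : e ∈ M.E) (heB : e ∉ B) (hx : x ∈ B) :
    M.IsBase (insert e (B \ {x})) ↔ x ∈ M.fundCircuit e B := by
  have hne : e ≠ x := fun h => heB (h ▸ hx)
  rw [hB.indep.mem_fundCircuit_iff (by rwa [hB.closure_eq]) heB,
    ← Set.insert_sdiff_singleton_comm hne]
  exact ⟨fun h => h.indep, fun h => hB.exchange_isBase_of_indep heB h⟩

/-- Simultaneous exchange along pairs `(s i, u i)` whose exchange arcs are triangular with respect
to a ranking `key`. -/
theorem Matroid.isBase_diff_union_of_triangular {α ι : Type*} [DecidableEq ι] {M : Matroid α}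
    {s u : ι → α} (key : ι → ℝ) (K : Finset ι) :
    ∀ B : Set α, M.IsBase B → (∀ i ∈ K, s i ∈ B) → (∀ i ∈ K, u i ∉ B) → (∀ i ∈ K, u i ∈ M.E) →
      Set.InjOn s K → Set.InjOn u K → (∀ i ∈ K, M.IsBase (insert (u i) (B \ {s i}))) →
      (∀ i ∈ K, ∀ j ∈ K, i ≠ j → M.IsBase (insert (u j) (B \ {s i})) → key i < key j) →
      M.IsBase ((B \ s '' K) ∪ u '' K) := by
  induction K using Finset.induction_on_max_value key with
  | empty => intro B hB; simpa using hB
  | insert i K hi hmax ih =>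
    intro B hB hs hu huE hsi hui hex htri
    have hiK : i ∈ insert i K := Finset.mem_insert_self i K
    have hK : ∀ {j}, j ∈ K → j ∈ insert i K := fun h => Finset.mem_insert_of_mem h
    have hne : ∀ {j}, j ∈ K → j ≠ i := fun h e => hi (e ▸ h)
    have hsne : ∀ j ∈ K, s j ≠ s i := fun j hj e => hne hj (hsi (hK hj) hiK e)
    have hune : ∀ j ∈ K, u j ≠ u i := fun j hj e => hne hj (hui (hK hj) hiK e)
    have hsub : (K : Set ι) ⊆ ((insert i K : Finset ι) : Set ι) := fun j hj => hK hj
    let B' : Set α := insert (u i) (B \ {s i})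
    have hB' : M.IsBase B' := hex i hiK
    have hs' : ∀ j ∈ K, s j ∈ B' := fun j hj => Or.inr ⟨hs j (hK hj), hsne j hj⟩
    have hu' : ∀ j ∈ K, u j ∉ B' := by
      rintro j hj (h | h)
      · exact hune j hj h
      · exact hu j (hK hj) h.1
    -- The pair `i` of largest key is exchanged first. If the circuit of `u j` contained `s i`,
    -- triangularity would give `key i < key j`. So the circuit survives in `insert (u j) B'`, and
    -- uniqueness of fundamental circuits applies.
    have hcirc : ∀ j ∈ K, M.fundCircuit (u j) B = M.fundCircuit (u j) B' := by
      intro j hj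
      refine (hB.fundCircuit_isCircuit (huE j (hK hj)) (hu j (hK hj))).eq_fundCircuit_of_subset
        hB'.indep fun x hx => ?_
      rcases M.fundCircuit_subset_insert _ _ hx with h | h
      · exact Or.inl h
      · refine Or.inr (Or.inr ⟨h, fun hxs => ?_⟩)
        rw [Set.mem_singleton_iff] at hxs
        subst hxs
        have := (hB.exchange_iff_mem_fundCircuit (huE j (hK hj)) (hu j (hK hj)) h).2 hx
        exact absurd (htri i hiK j (hK hj) (hne hj).symm this) (hmax j hj).not_gt
    have hiff : ∀ j ∈ K, ∀ k ∈ K, M.IsBase (insert (u k) (B' \ {s j})) ↔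
        M.IsBase (insert (u k) (B \ {s j})) := by
      intro j hj k hk
      rw [hB'.exchange_iff_mem_fundCircuit (huE k (hK hk)) (hu' k hk) (hs' j hj),
        hB.exchange_iff_mem_fundCircuit (huE k (hK hk)) (hu k (hK hk)) (hs j (hK hj)), hcirc k hk]
    have := ih B' hB' hs' hu' (fun j hj => huE j (hK hj)) (hsi.mono hsub) (hui.mono hsub)
      (fun j hj => (hiff j hj j hj).2 (hex j (hK hj)))
      (fun j hj k hk hjk h => htri j (hK hj) k (hK hk) hjk ((hiff j hj k hk).1 h))
    convert this using 1
    ext x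
    have hx : x = u i → ∀ j ∈ K, s j ≠ x := fun h j hj e =>
      hu i hiK (h ▸ e ▸ hs j (hK hj))
    simp only [B', Finset.coe_insert, Set.image_insert_eq, Set.mem_union, Set.mem_sdiff,
      Set.mem_insert_iff, Set.mem_image, Finset.mem_coe, Set.mem_singleton_iff]
    by_cases hxu : x = u i
    · have := hx hxu
      have h1 : ¬ ∃ j ∈ K, s j = x := fun ⟨j, hj, e⟩ => this j hj e
      tauto
    · simp only [hxu, false_or, not_or, and_assoc]

/-! ### Coefficients and change of volume -/

theorem coeff_of_mem {α : Type*} [DecidableEq α] {d : ℕ} (v : α → EuclideanSpace ℝ (Fin d))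
    (S : Finset α) (hS : S.card = d) (hvol : 0 < vol v S) (x y : S) :
    coeff v S y x = if x = y then 1 else 0 := by
  have e : Fin d ≃ S := (S.equivFinOfCardEq hS).symm
  have hspan : ⊤ ≤ Submodule.span ℝ (Set.range fun i : S => v i) := by
    -- Were the vectors not spanning, the default value 0 of `coeff` would make every `v u` vanish
    -- by `coeff_spec`, contradicting positive volume unless `d = 0`, where spanning is trivial.
    by_contra hcon
    have hzero : ∀ u t, coeff v S u t = 0 := fun u t => dif_neg fun h => hcon h.2
    have hv : ∀ u, v u = 0 := fun u => by simpa [hzero] using coeff_spec v S hS hvol u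
    refine hcon fun w _ => ?_
    rcases Nat.eq_zero_or_pos d with rfl | hd
    · rw [Subsingleton.elim w 0]; exact zero_mem _
    · rw [vol_eq_abs_det v S e, Matrix.det_eq_zero_of_row_eq_zero ⟨0, hd⟩ (by simp [hv])] at hvol
      simp at hvol
  have hli : LinearIndependent ℝ (fun i : S => v i) :=
    linearIndependent_of_top_le_span_of_card_eq_finrank hspan (by simp [hS])
  rw [coeff, dif_pos ⟨hli, hspan⟩]
  have := (Basis.mk hli hspan).repr_self y
  rw [Basis.mk_apply] at this
  rw [this, Finsupp.single_apply]
  simp [eq_comm]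

theorem vol_exchange {α : Type*} [DecidableEq α] {d l : ℕ} (v : α → EuclideanSpace ℝ (Fin d))
    (S : Finset α) (hS : S.card = d) (hvol : 0 < vol v S) (u s : Fin l → α)
    (hs : ∀ i, s i ∈ S) (hu : ∀ i, u i ∉ S) (hsi : s.Injective) (hui : u.Injective) :
    vol v ((S \ Finset.univ.image s) ∪ Finset.univ.image u) =
      |(Matrix.of fun i j => coeff v S (u i) ⟨s j, hs j⟩).det| * vol v S := by
  classical
  set T := (S \ Finset.univ.image s) ∪ Finset.univ.image u with hT
  have e : Fin d ≃ S := (S.equivFinOfCardEq hS).symm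
  let p : S → Prop := fun x => ∃ i, s i = x
  let g : S → α := fun x => if h : p x then u h.choose else x
  have hgs : ∀ i, g ⟨s i, hs i⟩ = u i := by
    intro i
    have h : p ⟨s i, hs i⟩ := ⟨i, rfl⟩
    simp only [g, dif_pos h]
    rw [hsi h.choose_spec]
  have hgn : ∀ x, ¬ p x → g x = x := fun x h => dif_neg h
  have hp : ∀ x, p x → ∃ i, x = ⟨s i, hs i⟩ := fun x ⟨i, hi⟩ => ⟨i, Subtype.ext hi.symm⟩
  have hgT : ∀ x, g x ∈ T := by
    intro x
    by_cases h : p x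
    · obtain ⟨i, rfl⟩ := hp x h
      rw [hgs]; simp [hT]
    · rw [hgn x h]
      refine Finset.mem_union_left _ (Finset.mem_sdiff.2 ⟨x.2, fun hx => h ?_⟩)
      simpa [p] using hx
  have hbij : Function.Bijective (fun x => (⟨g x, hgT x⟩ : T)) := by
    constructor
    · intro x y hxy
      have hxy' : g x = g y := congrArg Subtype.val hxy
      by_cases hx : p x <;> by_cases hy : p y
      · obtain ⟨i, rfl⟩ := hp x hx
        obtain ⟨j, rfl⟩ := hp y hy
        rw [hgs, hgs] at hxy'
        rw [hui hxy']
      · obtain ⟨i, rfl⟩ := hp x hx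
        rw [hgs, hgn y hy] at hxy'
        exact absurd (hxy' ▸ y.2) (hu i)
      · obtain ⟨i, rfl⟩ := hp y hy
        rw [hgs, hgn x hx] at hxy'
        exact absurd (hxy' ▸ x.2) (hu i)
      · rw [hgn x hx, hgn y hy] at hxy'
        exact Subtype.ext hxy'
    · rintro ⟨t, ht⟩
      rcases Finset.mem_union.1 ht with h | h
      · rw [Finset.mem_sdiff] at h
        refine ⟨⟨t, h.1⟩, Subtype.ext (hgn _ fun ⟨i, hi⟩ => h.2 ?_)⟩
        exact Finset.mem_image.2 ⟨i, Finset.mem_univ i, hi⟩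
      · obtain ⟨i, -, rfl⟩ := Finset.mem_image.1 h
        exact ⟨⟨s i, hs i⟩, Subtype.ext (hgs i)⟩
  -- The transition matrix from `S` to the new set. The columns of unexchanged elements are unit
  -- vectors, so it is block triangular with an identity block, leaving only the exchanged block.
  let A : Matrix S S ℝ := Matrix.of fun x y => coeff v S (g y) x
  have hA : A.det = (Matrix.of fun i j => coeff v S (u i) ⟨s j, hs j⟩).det := by
    rw [Matrix.twoBlockTriangular_det' A p]
    · have h1 : A.toSquareBlockProp (fun x => ¬ p x) = 1 := by
        ext x y
        simp only [A, Matrix.toSquareBlockProp_def, Matrix.of_apply, hgn _ y.2, Matrix.one_apply,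
          coeff_of_mem v S hS hvol, Subtype.ext_iff]
      let q : Fin l ≃ {x : S // p x} := Equiv.ofBijective (fun i => ⟨⟨s i, hs i⟩, i, rfl⟩)
        ⟨fun i j h => hsi (congrArg (fun z => (z.1.1 : α)) h), fun ⟨x, hx⟩ => by
          obtain ⟨i, rfl⟩ := hp x hx
          exact ⟨i, rfl⟩⟩
      rw [h1, Matrix.det_one, mul_one, ← Matrix.det_submatrix_equiv_self q, ← Matrix.det_transpose]
      congr 1
      ext i j
      change coeff v S (g ⟨s i, hs i⟩) ⟨s j, hs j⟩ = coeff v S (u i) ⟨s j, hs j⟩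
      rw [hgs]
    · intro x hx y hy
      simp only [A, Matrix.of_apply, hgn y hy, coeff_of_mem v S hS hvol]
      rw [if_neg]
      rintro rfl
      exact hy hx
  have hprod : (Matrix.of fun i j => v (e.trans (Equiv.ofBijective _ hbij) j : T) i) =
      (Matrix.of fun i j => v (e j) i) * A.submatrix e e := by
    ext i j
    simp only [Matrix.of_apply, Matrix.mul_apply, Matrix.submatrix_apply, A, Equiv.trans_apply,
      Equiv.ofBijective_apply]
    rw [coeff_spec v S hS hvol (g (e j)), ← e.sum_comp]
    simp [mul_comm]
  rw [vol_eq_abs_det v T (e.trans (Equiv.ofBijective _ hbij)), vol_eq_abs_det v S e, hprod,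
    Matrix.det_mul, Matrix.det_submatrix_equiv_self, hA, abs_mul, mul_comm]

/-! ### Directed cycles as periodic alternating sequences -/

theorem finRotate_mk_mod {n : ℕ} (hn : 0 < n) (k : ℕ) :
    finRotate n ⟨k % n, Nat.mod_lt _ hn⟩ = ⟨(k + 1) % n, Nat.mod_lt _ hn⟩ := by
  obtain ⟨m, rfl⟩ := Nat.exists_eq_succ_of_ne_zero hn.ne'
  rw [finRotate_apply]
  ext
  simp [Fin.val_add]

theorem DirectedCycle.card_verts {α : Type*} [DecidableEq α] {G : Digraph α}
    (C : DirectedCycle G) : C.verts.card = C.length := by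
  rw [DirectedCycle.verts, Finset.card_image_of_injective _ C.injective, Finset.card_univ,
    Fintype.card_fin]

theorem sum_range_two_mul {β : Type*} [AddCommMonoid β] (F : ℕ → β) (m : ℕ) :
    ∑ k ∈ Finset.range (2 * m), F k = ∑ i ∈ Finset.range m, (F (2 * i) + F (2 * i + 1)) := by
  induction m with
  | zero => simp
  | succ m ih =>
    rw [show 2 * (m + 1) = 2 * m + 1 + 1 by ring, Finset.sum_range_succ, Finset.sum_range_succ, ih,
      Finset.sum_range_succ, add_assoc]

theorem sum_range_add_one_of_periodic {β : Type*} [AddCommMonoid β] {F : ℕ → β} {n : ℕ}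
    (hF : F n = F 0) : ∑ k ∈ Finset.range n, F (k + 1) = ∑ k ∈ Finset.range n, F k := by
  cases n with
  | zero => simp
  | succ m => rw [Finset.sum_range_succ, Finset.sum_range_succ', hF]

section

variable {α : Type*} [DecidableEq α] {d : ℕ} {v : α → EuclideanSpace ℝ (Fin d)} {M : Matroid α}
  {S : Finset α}

theorem arcWeight_of_notMem {x y : α} (h : y ∉ S) : arcWeight v S x y = 0 := dif_neg h

/-- A directed cycle of the exchange graph, assembled from its forward arcs `u k → s k`. -/
theorem exists_directedCycle (v : α → EuclideanSpace ℝ (Fin d)) {m : ℕ} (hm : 0 < m)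
    {u s : ℕ → α} (huE : ∀ k < m, u k ∈ M.E) (huS : ∀ k < m, u k ∉ S) (hs : ∀ k < m, s k ∈ S)
    (hadj : ∀ k, k + 1 < m → M.IsBase (insert (u (k + 1)) (S.erase (s k)) : Finset α))
    (hlast : M.IsBase (insert (u 0) (S.erase (s (m - 1))) : Finset α))
    (hui : Set.InjOn u (Set.Iio m)) (hsi : Set.InjOn s (Set.Iio m)) :
    ∃ C : DirectedCycle (exchangeGraph M S), C.length = 2 * m ∧
      C.verts = (Finset.range m).image u ∪ (Finset.range m).image s ∧
      cycleWeight v M S C = ∑ k ∈ Finset.range m, arcWeight v S (u k) (s k) := by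
  have h2m : 0 < 2 * m := by omega
  let q : ℕ → α := fun k => if k % 2 = 0 then u (k / 2) else s (k / 2)
  have q0 : ∀ k, q (2 * k) = u k := fun k => by simp [q]
  have q1 : ∀ k, q (2 * k + 1) = s k := fun k => by
    simp [q, Nat.add_mod, show (2 * k + 1) / 2 = k by omega]
  have qi : Set.InjOn q (Set.Iio (2 * m)) := by
    intro a ha b hb hab
    rw [Set.mem_Iio] at ha hb
    obtain ⟨i, rfl | rfl⟩ := a.even_or_odd' <;> obtain ⟨j, rfl | rfl⟩ := b.even_or_odd' <;>
      simp only [q0, q1] at hab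
    · rw [hui (by simp; omega) (by simp; omega) hab]
    · exact absurd (hab ▸ hs j (by omega)) (huS i (by omega))
    · exact absurd (hab ▸ hs i (by omega)) (huS j (by omega))
    · rw [hsi (by simp; omega) (by simp; omega) hab]
  have hrot : ∀ i : Fin (2 * m), (finRotate (2 * m) i : ℕ) = (i + 1) % (2 * m) := by
    intro i
    have := finRotate_mk_mod h2m i
    simp only [Nat.mod_eq_of_lt i.2, Fin.eta] at this
    rw [this]
  have hG : ∀ k < 2 * m, (exchangeGraph M S).Adj (q k) (q ((k + 1) % (2 * m))) := by
    intro k hk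
    obtain ⟨i, rfl | rfl⟩ := k.even_or_odd'
    · rw [Nat.mod_eq_of_lt (by omega), q0, q1]
      exact Or.inl ⟨huE i (by omega), huS i (by omega), hs i (by omega)⟩
    · rw [q1]
      rcases (show i + 1 < m ∨ i = m - 1 by omega) with h | h
      · rw [Nat.mod_eq_of_lt (by omega), show 2 * i + 1 + 1 = 2 * (i + 1) by ring, q0]
        exact Or.inr ⟨hs i (by omega), huE _ h, huS _ h, hadj i h⟩
      · rw [show 2 * i + 1 + 1 = 2 * m by omega, Nat.mod_self, ← mul_zero 2, q0]
        exact Or.inr ⟨hs i (by omega), huE 0 hm, huS 0 hm, h ▸ hlast⟩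
  refine ⟨⟨2 * m, h2m, fun i => q i, fun i j h => Fin.ext (qi i.2 j.2 h), fun i => ?_⟩, rfl, ?_, ?_⟩
  · simp only [hrot]
    exact hG i i.2
  · ext x
    simp only [DirectedCycle.verts, Finset.mem_image, Finset.mem_univ, true_and, Finset.mem_union,
      Finset.mem_range]
    constructor
    · rintro ⟨⟨k, hk⟩, rfl⟩
      obtain ⟨i, rfl | rfl⟩ := k.even_or_odd'
      · exact Or.inl ⟨i, by omega, (q0 i).symm⟩
      · exact Or.inr ⟨i, by omega, (q1 i).symm⟩
    · rintro (⟨i, hi, rfl⟩ | ⟨i, hi, rfl⟩)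
      · exact ⟨⟨2 * i, by omega⟩, q0 i⟩
      · exact ⟨⟨2 * i + 1, by omega⟩, q1 i⟩
  · simp only [cycleWeight, hrot]
    rw [Fin.sum_univ_eq_sum_range (fun k => arcWeight v S (q k) (q ((k + 1) % (2 * m)))) (2 * m),
      sum_range_two_mul]
    refine Finset.sum_congr rfl fun i hi => ?_
    rw [Finset.mem_range] at hi
    rw [Nat.mod_eq_of_lt (by omega), q0, q1]
    rw [arcWeight_of_notMem (y := q _), add_zero]
    rcases (show i + 1 < m ∨ i = m - 1 by omega) with h | h
    · rw [Nat.mod_eq_of_lt (by omega), show 2 * i + 1 + 1 = 2 * (i + 1) by ring, q0]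
      exact huS _ h
    · rw [show 2 * i + 1 + 1 = 2 * m by omega, Nat.mod_self, ← mul_zero 2, q0]
      exact huS 0 hm

/-- Periodic sequences `u`, `s` of period `l` that run through the vertices of an alternating cycle
`u 0 → s 0 → u 1 → s 1 → ⋯` of the exchange graph. -/
structure IsAlternatingCycle (M : Matroid α) (S : Finset α) (l : ℕ) (u s : ℕ → α) : Prop where
  pos : 0 < l
  mem_ground (i : ℕ) : u i ∈ M.E
  notMem (i : ℕ) : u i ∉ S
  mem (i : ℕ) : s i ∈ S
  exchange (i : ℕ) : M.IsBase (insert (u (i + 1)) (S.erase (s i)) : Finset α)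
  periodic_left (i : ℕ) : u (i + l) = u i
  periodic_right (i : ℕ) : s (i + l) = s i
  modEq_of_left {i j : ℕ} : u i = u j → i ≡ j [MOD l]
  modEq_of_right {i j : ℕ} : s i = s j → i ≡ j [MOD l]

theorem DirectedCycle.exists_isAlternatingCycle (v : α → EuclideanSpace ℝ (Fin d))
    (C : DirectedCycle (exchangeGraph M S)) :
    ∃ (l : ℕ) (u s : ℕ → α), IsAlternatingCycle M S l u s ∧ C.length = 2 * l ∧
      C.verts = (Finset.range l).image u ∪ (Finset.range l).image s ∧
      cycleWeight v M S C = ∑ k ∈ Finset.range l, arcWeight v S (u k) (s k) := by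
  have hn := C.length_pos
  let p : ℕ → α := fun k => C.vertex ⟨k % C.length, Nat.mod_lt _ hn⟩
  have hadj : ∀ k, (exchangeGraph M S).Adj (p k) (p (k + 1)) := by
    intro k
    have := C.adj ⟨k % C.length, Nat.mod_lt _ hn⟩
    rwa [finRotate_mk_mod hn] at this
  have hper : ∀ k, p (k + C.length) = p k := fun k => by simp [p]
  have hmod : ∀ {a b}, p a = p b → a ≡ b [MOD C.length] := fun h =>
    congrArg Fin.val (C.injective h)
  have hpar : ∀ k, p (k + 1) ∈ S ↔ p k ∉ S := by
    intro k
    rcases hadj k with h | h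
    · simp [h.2.1, h.2.2]
    · simp [h.1, h.2.2.1]
  have heven : ∀ k, p k ∈ S ↔ (p 0 ∈ S ↔ Even k) := by
    intro k
    induction k with
    | zero => simp
    | succ k ih => rw [hpar, ih, Nat.even_add_one]; tauto
  have hlen : Even C.length := by
    have h1 := heven C.length
    have h2 := hper 0
    rw [zero_add] at h2
    rw [h2] at h1
    tauto
  obtain ⟨l, hl⟩ := hlen.exists_two_nsmul
  rw [nsmul_eq_mul, Nat.cast_ofNat] at hl
  -- The offset `o` rotates the cycle so that it starts outside `S`, with a forward arc.
  obtain ⟨o, ho, ho1⟩ : ∃ o, p o ∉ S ∧ o ≤ 1 := by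
    by_cases h : p 0 ∈ S
    · exact ⟨1, by rw [show 1 = 0 + 1 from rfl, hpar]; simpa using h, le_rfl⟩
    · exact ⟨0, h, zero_le_one⟩
  have hu : ∀ i, p (o + 2 * i) ∉ S := by
    intro i
    have h1 := heven (o + 2 * i)
    have h2 := heven o
    have h3 : Even (o + 2 * i) ↔ Even o := by simp [Nat.even_add]
    tauto
  have hs : ∀ i, p (o + 2 * i + 1) ∈ S := fun i => (hpar _).2 (hu i)
  have hwt : cycleWeight v M S C =
      ∑ k ∈ Finset.range C.length, arcWeight v S (p (o + k)) (p (o + k + 1)) := by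
    have h0 : cycleWeight v M S C =
        ∑ k ∈ Finset.range C.length, arcWeight v S (p k) (p (k + 1)) := by
      rw [cycleWeight, ← Fin.sum_univ_eq_sum_range (fun k => arcWeight v S (p k) (p (k + 1)))]
      refine Finset.sum_congr rfl fun i _ => ?_
      have := finRotate_mk_mod hn i
      simp only [Nat.mod_eq_of_lt i.2, Fin.eta] at this
      simp only [p, Nat.mod_eq_of_lt i.2, Fin.eta, this]
    rw [h0]
    rcases (show o = 0 ∨ o = 1 by omega) with rfl | rfl
    · simp
    · have h1 := hper 0
      have h2 := hper 1
      rw [zero_add] at h1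
      rw [← sum_range_add_one_of_periodic (F := fun k => arcWeight v S (p k) (p (k + 1)))]
      · simp only [add_comm 1]
      · simp only [h1, add_comm C.length, h2, zero_add]
  have hmod2 : ∀ {a b : ℕ}, o + 2 * a ≡ o + 2 * b [MOD 2 * l] → a ≡ b [MOD l] := fun h =>
    Nat.ModEq.mul_left_cancel' two_ne_zero (Nat.ModEq.add_left_cancel' o h)
  refine ⟨l, fun i => p (o + 2 * i), fun i => p (o + 2 * i + 1), ⟨by omega, ?_, hu, hs, ?_, ?_, ?_,
    ?_, ?_⟩, hl, ?_, ?_⟩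
  · intro i
    rcases hadj (o + 2 * i) with h | h
    · exact h.1
    · exact absurd h.1 (hu i)
  · intro i
    rcases hadj (o + 2 * i + 1) with h | h
    · exact absurd (hs i) h.2.1
    · exact h.2.2.2
  · intro i
    rw [← hper (o + 2 * i), hl]
    congr 1
    ring
  · intro i
    rw [← hper (o + 2 * i + 1), hl]
    congr 1
    ring
  · intro i j h
    have := hmod h
    rw [hl] at this
    exact hmod2 this
  · intro i j h
    have := hmod h
    rw [hl] at this
    exact hmod2 (Nat.ModEq.add_right_cancel' 1 this)
  · symm
    apply Finset.eq_of_subset_of_card_le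
    · intro x hx
      simp only [Finset.mem_union, Finset.mem_image, DirectedCycle.verts, Finset.mem_univ,
        true_and] at hx ⊢
      rcases hx with ⟨i, -, rfl⟩ | ⟨i, -, rfl⟩ <;> exact ⟨_, rfl⟩
    · rw [C.card_verts, Finset.card_union_of_disjoint, Finset.card_image_of_injOn,
        Finset.card_image_of_injOn, Finset.card_range]
      · omega
      · intro i hi j hj h
        have := hmod h
        rw [hl] at this
        rw [Finset.coe_range, Set.mem_Iio] at hi hj
        exact (hmod2 (Nat.ModEq.add_right_cancel' 1 this)).eq_of_lt_of_lt hi hj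
      · intro i hi j hj h
        have := hmod h
        rw [hl] at this
        rw [Finset.coe_range, Set.mem_Iio] at hi hj
        exact (hmod2 this).eq_of_lt_of_lt hi hj
      · rw [Finset.disjoint_left]
        intro x hx hx'
        obtain ⟨i, -, rfl⟩ := Finset.mem_image.1 hx
        obtain ⟨j, -, h⟩ := Finset.mem_image.1 hx'
        exact hu i (h ▸ hs j)
  · rw [hwt, hl, sum_range_two_mul]
    refine Finset.sum_congr rfl fun i _ => ?_
    rw [show o + (2 * i + 1) + 1 = o + 2 * (i + 1) by ring,
      arcWeight_of_notMem (x := p (o + (2 * i + 1))) (hu (i + 1)), add_zero]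

end

/-! ### From extended weights to real logarithms -/

theorem EReal.sum_coe {ι : Type*} (s : Finset ι) (f : ι → ℝ) :
    ∑ i ∈ s, (f i : EReal) = ((∑ i ∈ s, f i : ℝ) : EReal) := by
  classical
  induction s using Finset.induction_on with
  | empty => simp
  | insert a s ha ih => rw [Finset.sum_insert ha, Finset.sum_insert ha, ih, EReal.coe_add]

theorem EReal.sum_ne_bot {ι : Type*} {s : Finset ι} {f : ι → EReal} (h : ∀ i ∈ s, f i ≠ ⊥) :
    ∑ i ∈ s, f i ≠ ⊥ :=
  Finset.sum_induction f (fun x => x ≠ ⊥)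
    (fun _ _ ha hb => by simp [EReal.add_eq_bot_iff, ha, hb]) EReal.zero_ne_bot h

theorem EReal.sum_eq_top {ι : Type*} {s : Finset ι} {f : ι → EReal}
    (h : ∀ i ∈ s, f i ≠ ⊥) {k : ι} (hk : k ∈ s) (hf : f k = ⊤) : ∑ i ∈ s, f i = ⊤ := by
  classical
  rw [← Finset.add_sum_erase s f hk, hf]
  exact EReal.top_add_of_ne_bot (EReal.sum_ne_bot fun i hi => h i (Finset.mem_of_mem_erase hi))

section

variable {α : Type*} {d : ℕ}

/-- The coefficient of `v y` in the expression of `v x` in `S`, for any element `y`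
(`0` if `y ∉ S`). -/
noncomputable def exchangeCoeff (v : α → EuclideanSpace ℝ (Fin d)) (S : Finset α) (x y : α) : ℝ :=
  open Classical in if h : y ∈ S then coeff v S x ⟨y, h⟩ else 0

variable {v : α → EuclideanSpace ℝ (Fin d)} {S : Finset α}

theorem exchangeCoeff_of_mem {x y : α} (h : y ∈ S) :
    exchangeCoeff v S x y = coeff v S x ⟨y, h⟩ := dif_pos h

variable [DecidableEq α] {M : Matroid α}

theorem arcWeight_of_ne_zero {x y : α} (hy : y ∈ S) (h : exchangeCoeff v S x y ≠ 0) :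
    arcWeight v S x y = ((-Real.log |exchangeCoeff v S x y| : ℝ) : EReal) := by
  rw [exchangeCoeff_of_mem hy] at h ⊢
  rw [arcWeight, dif_pos hy, if_neg h]

theorem arcWeight_of_eq_zero {x y : α} (hy : y ∈ S) (h : exchangeCoeff v S x y = 0) :
    arcWeight v S x y = ⊤ := by
  rw [exchangeCoeff_of_mem hy] at h
  rw [arcWeight, dif_pos hy, if_pos h]

theorem arcWeight_ne_bot (x y : α) : arcWeight v S x y ≠ ⊥ := by
  unfold arcWeight
  split_ifs
  · exact top_ne_bot
  · exact EReal.coe_ne_bot _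
  · exact EReal.zero_ne_bot

/-- No weight is `⊥`, so a single vanishing coefficient makes the sum `⊤`; otherwise the inequality
is one between reals. -/
theorem sum_arcWeight_lt_iff {m : ℕ} {u s : ℕ → α} {c : ℝ} (hs : ∀ k < m, s k ∈ S) :
    ∑ k ∈ Finset.range m, arcWeight v S (u k) (s k) < ((-c : ℝ) : EReal) ↔
      (∀ k < m, exchangeCoeff v S (u k) (s k) ≠ 0) ∧
        c < ∑ k ∈ Finset.range m, Real.log |exchangeCoeff v S (u k) (s k)| := by
  by_cases h0 : ∀ k < m, exchangeCoeff v S (u k) (s k) ≠ 0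
  · rw [Finset.sum_congr rfl fun k hk => arcWeight_of_ne_zero (hs k (Finset.mem_range.1 hk))
      (h0 k (Finset.mem_range.1 hk)), EReal.sum_coe, EReal.coe_lt_coe_iff, Finset.sum_neg_distrib,
      neg_lt_neg_iff]
    exact ⟨fun h => ⟨h0, h⟩, fun h => h.2⟩
  · refine iff_of_false ?_ fun h => h0 h.1
    push Not at h0
    obtain ⟨k, hk, h⟩ := h0
    rw [EReal.sum_eq_top (fun i _ => arcWeight_ne_bot _ _) (Finset.mem_range.2 hk)
      (arcWeight_of_eq_zero (hs k hk) h)]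
    exact not_top_lt

/-! ### Chords and minimality -/

namespace IsAlternatingCycle

variable {l : ℕ} {u s : ℕ → α}

theorem left_mod (h : IsAlternatingCycle M S l u s) (i : ℕ) : u (i % l) = u i :=
  Function.Periodic.map_mod_nat (fun i => h.periodic_left i) i

theorem right_mod (h : IsAlternatingCycle M S l u s) (i : ℕ) : s (i % l) = s i :=
  Function.Periodic.map_mod_nat (fun i => h.periodic_right i) i

theorem left_mem_image (h : IsAlternatingCycle M S l u s) (i : ℕ) :
    u i ∈ (Finset.range l).image u :=
  Finset.mem_image.2 ⟨i % l, Finset.mem_range.2 (Nat.mod_lt _ h.pos), h.left_mod i⟩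

theorem right_mem_image (h : IsAlternatingCycle M S l u s) (i : ℕ) :
    s i ∈ (Finset.range l).image s :=
  Finset.mem_image.2 ⟨i % l, Finset.mem_range.2 (Nat.mod_lt _ h.pos), h.right_mod i⟩

theorem image_left_succ (h : IsAlternatingCycle M S l u s) :
    (Finset.range l).image (fun i => u (i + 1)) = (Finset.range l).image u := by
  have hl := h.pos
  ext x
  constructor <;> intro hx <;> obtain ⟨i, hi, rfl⟩ := Finset.mem_image.1 hx
  · exact h.left_mem_image _
  · refine Finset.mem_image.2 ⟨(i + (l - 1)) % l, Finset.mem_range.2 (Nat.mod_lt _ hl), ?_⟩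
    rw [← h.left_mod, Nat.mod_add_mod, h.left_mod, ← h.periodic_left i]
    congr 1
    omega

theorem modEq_add_left_lt {j a b : ℕ} (h : j + a ≡ j + b [MOD l]) (ha : a < l) (hb : b < l) :
    a = b :=
  (Nat.ModEq.add_left_cancel' j h).eq_of_lt_of_lt ha hb

/-- In a minimal violating cycle, a shorter cycle on the same vertices is not violating. -/
theorem not_sum_arcWeight_lt {C : DirectedCycle (exchangeGraph M S)}
    (hC : IsMinimalViolating v M S C) (h : IsAlternatingCycle M S l u s)
    (hlen : C.length = 2 * l)
    (hverts : C.verts = (Finset.range l).image u ∪ (Finset.range l).image s)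
    {m : ℕ} (hm : 0 < m) (hml : m < l) {a b : ℕ → ℕ}
    (ha : ∀ i < m, ∀ j < m, a i ≡ a j [MOD l] → i = j)
    (hb : ∀ i < m, ∀ j < m, b i ≡ b j [MOD l] → i = j)
    (hadj : ∀ k, k + 1 < m → a (k + 1) = b k + 1)
    (hlast : M.IsBase (insert (u (a 0)) (S.erase (s (b (m - 1)))) : Finset α)) :
    ¬ ((∀ k < m, exchangeCoeff v S (u (a k)) (s (b k)) ≠ 0) ∧ Real.log (violationBound m) <
      ∑ k ∈ Finset.range m, Real.log |exchangeCoeff v S (u (a k)) (s (b k))|) := by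
  obtain ⟨C', hlen', hverts', hw⟩ := exists_directedCycle (M := M) (S := S) v hm
    (u := fun k => u (a k)) (s := fun k => s (b k))
    (fun k _ => h.mem_ground _) (fun k _ => h.notMem _) (fun k _ => h.mem _)
    (fun k hk => by
      have := h.exchange (b k)
      rwa [← hadj k hk] at this) hlast
    (fun i hi j hj e => ha i hi j hj (h.modEq_of_left e))
    (fun i hi j hj e => hb i hi j hj (h.modEq_of_right e))
  rw [← sum_arcWeight_lt_iff (fun k _ => h.mem _), ← hw]
  have hsub : C'.verts ⊆ C.verts := by
    rw [hverts, hverts']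
    refine Finset.union_subset_union (fun x hx => ?_) fun x hx => ?_ <;>
      obtain ⟨i, -, rfl⟩ := Finset.mem_image.1 hx
    · exact h.left_mem_image _
    · exact h.right_mem_image _
  have hne : C'.verts ≠ C.verts := by
    intro he
    have := congrArg Finset.card he
    rw [C'.card_verts, C.card_verts] at this
    omega
  have := hC.2 C' (hsub.ssubset_of_ne hne)
  rwa [IsViolating, hlen', Nat.mul_div_cancel_left _ two_pos] at this

end IsAlternatingCycle

/-- The analytic content of minimality, for an alternating cycle whose `i`-th forward arc has
weight `-w i`: bounds for the chords, both forward and backward. -/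
structure IsTightCycle (v : α → EuclideanSpace ℝ (Fin d)) (M : Matroid α) (S : Finset α) (l : ℕ)
    (u s : ℕ → α) (w : ℕ → ℝ) : Prop extends IsAlternatingCycle M S l u s where
  log_eq (i : ℕ) : w i = Real.log |exchangeCoeff v S (u i) (s i)|
  ne_zero (i : ℕ) : exchangeCoeff v S (u i) (s i) ≠ 0
  lt_sum : Real.log (violationBound l) < ∑ k ∈ Finset.range l, w k
  forward_le (j m : ℕ) : m + 1 < l → exchangeCoeff v S (u (j + 1 + m)) (s j) ≠ 0 →
    Real.log |exchangeCoeff v S (u (j + 1 + m)) (s j)| + ∑ k ∈ Finset.range m, w (j + 1 + k) ≤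
      Real.log (violationBound (m + 1))
  backward_le (j m : ℕ) : m + 1 < l →
    M.IsBase (insert (u j) (S.erase (s (j + m))) : Finset α) →
    ∑ k ∈ Finset.range (m + 1), w (j + k) ≤ Real.log (violationBound (m + 1))

theorem IsMinimalViolating.exists_isTightCycle {C : DirectedCycle (exchangeGraph M S)}
    (hC : IsMinimalViolating v M S C) : ∃ (l : ℕ) (u s : ℕ → α) (w : ℕ → ℝ),
      IsTightCycle v M S l u s w ∧
        C.verts = (Finset.range l).image u ∪ (Finset.range l).image s := by
  obtain ⟨l, u, s, h, hlen, hverts, hw⟩ := C.exists_isAlternatingCycle v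
  have hviol := hC.1
  rw [IsViolating, hlen, Nat.mul_div_cancel_left _ two_pos, hw,
    sum_arcWeight_lt_iff (fun k _ => h.mem k)] at hviol
  have hne : ∀ i, exchangeCoeff v S (u i) (s i) ≠ 0 := fun i => by
    rw [← h.left_mod, ← h.right_mod]
    exact hviol.1 _ (Nat.mod_lt _ h.pos)
  refine ⟨l, u, s, fun i => Real.log |exchangeCoeff v S (u i) (s i)|,
    ⟨h, fun _ => rfl, hne, hviol.2, ?_, ?_⟩, hverts⟩
  · intro j m hm h0
    -- The cycle `u (j+1) → s (j+1) → ⋯ → u (j+1+m) → s j → u (j+1)`: a stretch of `C`, the forward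
    -- chord, and a backward arc of `C`.
    have := h.not_sum_arcWeight_lt hC hlen hverts (Nat.succ_pos m) hm
      (a := fun k => j + 1 + k) (b := fun k => if k < m then j + 1 + k else j)
      (fun i hi k hk e => IsAlternatingCycle.modEq_add_left_lt e (by omega) (by omega)) ?_
      (fun k hk => by simp only [if_pos (show k < m by omega)]; ring)
      (by simpa using h.exchange j)
    · rw [Finset.sum_range_succ] at this
      simp only [lt_irrefl, if_false] at this
      rw [Finset.sum_congr rfl fun k hk => by rw [if_pos (Finset.mem_range.1 hk)]] at this
      rw [add_comm]
      refine le_of_not_gt fun hlt => this ⟨fun k hk => ?_, hlt⟩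
      split_ifs with hkm
      · exact hne _
      · rwa [show k = m by omega]
    · intro i hi k hk e
      split_ifs at e with h1 h2 h2
      · exact IsAlternatingCycle.modEq_add_left_lt e (by omega) (by omega)
      · rw [add_assoc] at e
        have := IsAlternatingCycle.modEq_add_left_lt (b := 0) e (by omega) (by omega)
        omega
      · rw [add_assoc] at e
        have := IsAlternatingCycle.modEq_add_left_lt (a := 0) e (by omega) (by omega)
        omega
      · omega
  · intro j m hm hb
    -- The cycle `u j → s j → ⋯ → s (j+m) → u j`, closed by the backward chord.
    have := h.not_sum_arcWeight_lt hC hlen hverts (Nat.succ_pos m) hm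
      (a := fun k => j + k) (b := fun k => j + k)
      (fun i hi k hk e => IsAlternatingCycle.modEq_add_left_lt e (by omega) (by omega))
      (fun i hi k hk e => IsAlternatingCycle.modEq_add_left_lt e (by omega) (by omega))
      (fun k hk => by ring) (by simpa using hb)
    exact le_of_not_gt fun hlt => this ⟨fun k _ => hne _, hlt⟩

/-- The potential: partial sums of the deviation of `w` from its mean over a period `l`. -/
noncomputable def potential (w : ℕ → ℝ) (l k : ℕ) : ℝ :=
  ∑ t ∈ Finset.range k, (w t - (∑ t ∈ Finset.range l, w t) / l)

theorem potential_succ (w : ℕ → ℝ) (l k : ℕ) :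
    potential w l (k + 1) = potential w l k + (w k - (∑ t ∈ Finset.range l, w t) / l) :=
  Finset.sum_range_succ _ _

theorem sum_range_eq_potential (w : ℕ → ℝ) (l j m : ℕ) :
    ∑ k ∈ Finset.range m, w (j + k) = potential w l (j + m) - potential w l j +
      m * ((∑ t ∈ Finset.range l, w t) / l) := by
  induction m with
  | zero => simp
  | succ m ih =>
    rw [Finset.sum_range_succ, ih, ← add_assoc, potential_succ]
    push_cast
    ring

/-! ### The potential, the new basis and the determinant -/

namespace IsTightCycle

variable {l : ℕ} {u s : ℕ → α} {w : ℕ → ℝ}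

theorem potential_add_period (h : IsTightCycle v M S l u s w) (k : ℕ) :
    potential w l (k + l) = potential w l k := by
  have hl : (l : ℝ) ≠ 0 := Nat.cast_ne_zero.2 h.pos.ne'
  induction k with
  | zero =>
    rw [zero_add, potential, Finset.sum_sub_distrib, Finset.sum_const, Finset.card_range,
      nsmul_eq_mul, mul_div_cancel₀ _ hl, sub_self]
    rfl
  | succ k ih =>
    rw [show k + 1 + l = k + l + 1 by ring, potential_succ, potential_succ, ih, h.log_eq (k + l),
      h.log_eq k, h.periodic_left, h.periodic_right]

/-- The chord closes a cycle with fewer than `l` forward arcs, so their mean gain is strictly below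
the overall mean, and the potential drops along them from `j + 1` to `i + 1`, cyclically. -/
theorem potential_lt (h : IsTightCycle v M S l u s w) {i j : ℕ} (hi : i < l) (hj : j < l)
    (hij : i ≠ j) (hb : M.IsBase (insert (u (j + 1)) (S.erase (s i)) : Finset α)) :
    potential w l (i + 1) < potential w l (j + 1) := by
  obtain ⟨m, hm, hs, hP⟩ : ∃ m, m + 1 < l ∧ s (j + 1 + m) = s i ∧
      potential w l (j + 1 + (m + 1)) = potential w l (i + 1) := by
    rcases hij.lt_or_gt with hlt | hlt
    · refine ⟨i + l - (j + 1), by omega, ?_, ?_⟩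
      · rw [show j + 1 + (i + l - (j + 1)) = i + l by omega, h.periodic_right]
      · rw [show j + 1 + (i + l - (j + 1) + 1) = i + 1 + l by omega, h.potential_add_period]
    · refine ⟨i - (j + 1), by omega, ?_, ?_⟩
      · rw [show j + 1 + (i - (j + 1)) = i by omega]
      · rw [show j + 1 + (i - (j + 1) + 1) = i + 1 by omega]
  rw [← hs] at hb
  have h1 := h.backward_le (j + 1) m hm hb
  rw [sum_range_eq_potential w l, hP] at h1
  have h2 := log_violationBound_sub_le h.pos hm.le h.lt_sum.le
  have h3 := mul_pos (Real.log_pos one_lt_two) (decayExp_pos (Nat.le_add_left 1 m) hm)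
  linarith

/-- Here `s i` is paired with `u (i + 1)`, along the backward arcs of `C`; the determinant pairs it
with `u i`. Both exchanges yield the same set. -/
theorem isBase (h : IsTightCycle v M S l u s w) (hS : M.IsBase (S : Set α)) :
    M.IsBase (((S \ (Finset.range l).image s) ∪ (Finset.range l).image u : Finset α) : Set α) := by
  have := Matroid.isBase_diff_union_of_triangular (M := M) (s := s) (u := fun i => u (i + 1))
    (fun i => potential w l (i + 1)) (Finset.range l) S hS (fun i _ => h.mem i)
    (fun i _ => h.notMem _) (fun i _ => h.mem_ground _) ?_ ?_
    (fun i _ => by simpa using h.exchange i)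
    (fun i hi j hj hij hb => h.potential_lt (Finset.mem_range.1 hi) (Finset.mem_range.1 hj) hij
      (by simpa using hb))
  · rw [← h.image_left_succ]
    simpa using this
  · intro i hi j hj e
    rw [Finset.coe_range, Set.mem_Iio] at hi hj
    exact (h.modEq_of_right e).eq_of_lt_of_lt hi hj
  · intro i hi j hj e
    rw [Finset.coe_range, Set.mem_Iio] at hi hj
    exact (Nat.ModEq.add_right_cancel' 1 (h.modEq_of_left e)).eq_of_lt_of_lt hi hj

/-- The matrix of coefficients of the cycle, with rows and columns rescaled by the potential. -/
noncomputable def scaledMatrix (v : α → EuclideanSpace ℝ (Fin d)) (S : Finset α) (l : ℕ)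
    (u s : ℕ → α) (w : ℕ → ℝ) : Matrix (Fin l) (Fin l) ℝ :=
  Matrix.of fun i j => Real.exp (-potential w l (j + 1) - (∑ t ∈ Finset.range l, w t) / l) *
    Matrix.of (fun i j : Fin l =>
      Real.exp (potential w l i) * exchangeCoeff v S (u i) (s j)) i j

/-- By periodicity the potentials of rows and columns cancel in the product; `l` copies of the mean
remain. -/
theorem det_scaledMatrix (h : IsTightCycle v M S l u s w) :
    (scaledMatrix v S l u s w).det = Real.exp (-∑ t ∈ Finset.range l, w t) *
      (Matrix.of fun i j : Fin l => exchangeCoeff v S (u i) (s j)).det := by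
  have hl : (l : ℝ) ≠ 0 := Nat.cast_ne_zero.2 h.pos.ne'
  have hA := Matrix.det_mul_column (fun i : Fin l => Real.exp (potential w l i))
    (Matrix.of fun i j : Fin l => exchangeCoeff v S (u i) (s j))
  simp only [Matrix.of_apply] at hA
  rw [scaledMatrix, Matrix.det_mul_row, hA, ← mul_assoc, ← Real.exp_sum, ← Real.exp_sum,
    ← Real.exp_add]
  congr 2
  rw [Fin.sum_univ_eq_sum_range (fun i => potential w l i), Fin.sum_univ_eq_sum_range
    (fun j => -potential w l (j + 1) - (∑ t ∈ Finset.range l, w t) / l), Finset.sum_sub_distrib,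
    Finset.sum_neg_distrib, sum_range_add_one_of_periodic (F := fun k => potential w l k),
    Finset.sum_const, Finset.card_range, nsmul_eq_mul, mul_div_cancel₀ _ hl]
  · ring
  · simpa using h.potential_add_period 0

theorem abs_scaledMatrix_diag (h : IsTightCycle v M S l u s w) (i : Fin l) :
    |scaledMatrix v S l u s w i i| = 1 := by
  rw [scaledMatrix, Matrix.of_apply, Matrix.of_apply, abs_mul, abs_mul, Real.abs_exp, Real.abs_exp,
    ← Real.exp_log (abs_pos.2 (h.ne_zero i)), ← h.log_eq, ← Real.exp_add, ← Real.exp_add,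
    Real.exp_eq_one_iff, potential_succ]
  ring

/-- The residue `(i - j) mod l` counts the forward arcs of the cycle closed by the chord `u i → s
j`. In `forward_le` the potential absorbs the rest of that cycle. -/
theorem abs_scaledMatrix_le (h : IsTightCycle v M S l u s w) {i j : Fin l} (hij : j ≠ i) :
    |scaledMatrix v S l u s w i j| ≤ (2 : ℝ) ^ (-decayExp l ((i + l - j) % l)) := by
  by_cases h0 : exchangeCoeff v S (u i) (s j) = 0
  · rw [scaledMatrix, Matrix.of_apply, Matrix.of_apply, h0, mul_zero, mul_zero, abs_zero]
    positivity
  have hij' : (j : ℕ) ≠ i := fun e => hij (Fin.ext e)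
  have hi := i.2
  have hj := j.2
  obtain ⟨m, hm, hx, hu, hP⟩ : ∃ m, m + 1 < l ∧ ((i : ℕ) + l - j) % l = m + 1 ∧
      u (j + 1 + m) = u i ∧ potential w l (j + 1 + m) = potential w l i := by
    rcases hij'.lt_or_gt with hlt | hlt
    · refine ⟨i - j - 1, by omega, ?_, ?_, ?_⟩
      · rw [show (i : ℕ) + l - j = i - j + l by omega, Nat.add_mod_right,
          Nat.mod_eq_of_lt (by omega)]
        omega
      all_goals rw [show (j : ℕ) + 1 + (i - j - 1) = i by omega]
    · refine ⟨i + l - j - 1, by omega, ?_, ?_, ?_⟩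
      · rw [Nat.mod_eq_of_lt (by omega)]
        omega
      · rw [show (j : ℕ) + 1 + (i + l - j - 1) = i + l by omega, h.periodic_left]
      · rw [show (j : ℕ) + 1 + (i + l - j - 1) = i + l by omega, h.potential_add_period]
  have h1 := h.forward_le j m hm (by rwa [hu])
  rw [sum_range_eq_potential w l, hP, hu] at h1
  have h2 := log_violationBound_sub_le h.pos hm.le h.lt_sum.le
  rw [hx, scaledMatrix, Matrix.of_apply, Matrix.of_apply, abs_mul, abs_mul, Real.abs_exp,
    Real.abs_exp, Real.rpow_def_of_pos two_pos]
  nth_rewrite 1 [← Real.exp_log (abs_pos.2 h0)]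
  rw [← Real.exp_add, ← Real.exp_add, Real.exp_le_exp]
  push_cast at h2
  linarith

/-- Along a row the cyclic distances from the diagonal are distinct and lie in `[1, l)`. -/
theorem sum_abs_scaledMatrix_le (h : IsTightCycle v M S l u s w) (i : Fin l) :
    ∑ j ∈ Finset.univ.erase i, |scaledMatrix v S l u s w i j| ≤
      ∑ x ∈ Finset.Ico 1 l, (2 : ℝ) ^ (-decayExp l x) := by
  have hi := i.2
  have hmod : ∀ j : Fin l, j ≠ i → ((i : ℕ) + l - j) % l =
      if j < i then (i : ℕ) - j else i + l - j := by
    intro j hj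
    have hj' : (j : ℕ) ≠ i := fun e => hj (Fin.ext e)
    have hjl := j.2
    split_ifs with hlt
    · rw [Fin.lt_def] at hlt
      rw [show (i : ℕ) + l - j = i - j + l by omega, Nat.add_mod_right, Nat.mod_eq_of_lt (by omega)]
    · rw [Fin.lt_def] at hlt
      exact Nat.mod_eq_of_lt (by omega)
  have hinj : Set.InjOn (fun j : Fin l => ((i : ℕ) + l - j) % l)
      ((Finset.univ.erase i : Finset (Fin l)) : Set (Fin l)) := by
    intro a ha b hb hab
    have ha' := Finset.ne_of_mem_erase (Finset.mem_coe.1 ha)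
    have hb' := Finset.ne_of_mem_erase (Finset.mem_coe.1 hb)
    dsimp only at hab
    rw [hmod a ha', hmod b hb'] at hab
    have h1 := a.2
    have h2 := b.2
    apply Fin.ext
    simp only [Fin.lt_def] at hab
    split_ifs at hab <;> omega
  calc _ ≤ ∑ j ∈ Finset.univ.erase i, (2 : ℝ) ^ (-decayExp l (((i : ℕ) + l - j) % l)) :=
        Finset.sum_le_sum fun j hj => h.abs_scaledMatrix_le (Finset.ne_of_mem_erase hj)
    _ = ∑ x ∈ (Finset.univ.erase i).image (fun j : Fin l => ((i : ℕ) + l - j) % l),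
          (2 : ℝ) ^ (-decayExp l x) :=
        (Finset.sum_image (f := fun x => (2 : ℝ) ^ (-decayExp l x)) hinj).symm
    _ ≤ _ := by
        refine Finset.sum_le_sum_of_subset_of_nonneg ?_ fun _ _ _ => by positivity
        intro x hx
        obtain ⟨j, hj, rfl⟩ := Finset.mem_image.1 hx
        have hj' := Finset.ne_of_mem_erase hj
        have hj'' : (j : ℕ) ≠ i := fun e => hj' (Fin.ext e)
        have hjl := j.2
        simp only [hmod j hj', Finset.mem_Ico, Fin.lt_def]
        split_ifs <;> omega

theorem two_le_abs_det (h : IsTightCycle v M S l u s w) :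
    2 ≤ |(Matrix.of fun i j : Fin l => exchangeCoeff v S (u i) (s j)).det| := by
  obtain ⟨r, hr, hsum, hfac⟩ := exists_sum_decay_le l h.pos
  have h1 := one_sub_pow_le_abs_det _ hr.le h.abs_scaledMatrix_diag
    fun i => (h.sum_abs_scaledMatrix_le i).trans hsum
  rw [h.det_scaledMatrix, abs_mul, Real.abs_exp, Real.exp_neg, inv_mul_eq_div,
    le_div_iff₀ (Real.exp_pos _)] at h1
  -- Violation of `C` itself pays for undoing the scaling.
  have h2 : violationBound l ≤ Real.exp (∑ t ∈ Finset.range l, w t) :=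
    ((Real.log_lt_iff_lt_exp (violationBound_pos l)).1 h.lt_sum).le
  have h3 := mul_le_mul_of_nonneg_left h2 (pow_nonneg (sub_nonneg.2 hr.le) l)
  rw [violationBound] at h3
  linarith

theorem two_mul_vol_le (h : IsTightCycle v M S l u s w) (hS : S.card = d) (hvol : 0 < vol v S) :
    2 * vol v S ≤ vol v ((S \ (Finset.range l).image s) ∪ (Finset.range l).image u) := by
  have himg : ∀ f : ℕ → α, (Finset.range l).image f = Finset.univ.image fun i : Fin l => f i := by
    intro f
    ext x
    simp only [Finset.mem_image, Finset.mem_range, Finset.mem_univ, true_and]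
    exact ⟨fun ⟨i, hi, e⟩ => ⟨⟨i, hi⟩, e⟩, fun ⟨i, e⟩ => ⟨i, i.2, e⟩⟩
  rw [himg, himg, vol_exchange v S hS hvol (fun i : Fin l => u i) (fun i => s i)
    (fun i => h.mem i) (fun i => h.notMem i)
    (fun i j e => Fin.ext ((h.modEq_of_right e).eq_of_lt_of_lt i.2 j.2))
    (fun i j e => Fin.ext ((h.modEq_of_left e).eq_of_lt_of_lt i.2 j.2))]
  refine mul_le_mul_of_nonneg_right ?_ hvol.le
  have := h.two_le_abs_det
  simpa only [exchangeCoeff_of_mem (h.mem _)] using this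

theorem symmDiff_eq (h : IsTightCycle v M S l u s w) :
    S ∆ ((Finset.range l).image u ∪ (Finset.range l).image s) =
      (S \ (Finset.range l).image s) ∪ (Finset.range l).image u := by
  have hu : ∀ x ∈ (Finset.range l).image u, x ∉ S := by
    intro x hx
    obtain ⟨i, -, rfl⟩ := Finset.mem_image.1 hx
    exact h.notMem i
  have hs : ∀ x ∈ (Finset.range l).image s, x ∈ S := by
    intro x hx
    obtain ⟨i, -, rfl⟩ := Finset.mem_image.1 hx
    exact h.mem i
  ext x
  have := hu x
  have := hs x
  simp only [Finset.mem_symmDiff, Finset.mem_union, Finset.mem_sdiff]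
  tauto

end IsTightCycle

end

theorem mainTheorem5 {α : Type*} [Finite α] [DecidableEq α] {d : ℕ}
    (v : α → EuclideanSpace ℝ (Fin d)) (M : Matroid α) (hM : M.eRank = (d : ℕ∞))
    (S : Finset α) (hS : M.IsBase (S : Set α)) (hvol : 0 < vol v S)
    (C : DirectedCycle (exchangeGraph M S)) (hC : IsMinimalViolating v M S C) :
    2 * vol v S ≤ vol v (S ∆ C.verts) ∧ M.IsBase ((S ∆ C.verts : Finset α) : Set α) := by
  have hcard : S.card = d := by
    have := hS.encard_eq_eRank
    rw [hM, Set.encard_coe_eq_coe_finsetCard] at this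
    exact_mod_cast this
  obtain ⟨l, u, s, w, h, hverts⟩ := hC.exists_isTightCycle
  rw [hverts, h.symmDiff_eq]
  exact ⟨h.two_mul_vol_le hcard hvol, h.isBase hS⟩
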